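/- Theorem. Let $n\in\{2,3\}$, let $M_n=M_n(\mathbb C)$ with matrix units $E_{ij}$, and identify $M_n\otimes M_n$ with the operators on $\mathbb C^n\otimes\mathbb C^n$. For $x\in M_n\otimes M_n$ put $$\pi(x)=\inf\Big\{\sum_{i=1}^k\|a_i\|\,\|b_i\|_1 \;:\; k\in\mathbb N,\ a_i,b_i\in M_n,\ x=\sum_{i=1}^k a_i\otimes b_i\Big\},$$ where $\|\cdot\|$ is the operator norm and $\|b\|_1=\operatorname{Tr}(b^*b)^{1/2}$ is the trace norm, and let $$\alpha(\rho)=\sup\Big\{\frac{|\operatorname{Tr}(\rho a)|}{\pi(a)} \;:\; a\in M_n\otimes M_n,\ a\neq0\Big\}$$ be the dual norm. Let $\mathfrak D$ be the set of all $\rho\in M_n\otimes M_n$ such that $\rho=\rho^*$, $\alpha(\rho)=1$, $\operatorname{Tr}\rho=n$, and $\rho$ is block-positive, i.e. $(x\otimes y,\rho\,(x\otimes y))\ge0$ for all $x,y\in\mathbb C^n$. Let $w=\sum_{i,j=1}^nE_{ij}\otimes E_{ji}$ be the Choi matrix $\sum_{i,j}E_{ij}\otimes\tau(E_{ij})$ of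 the transposition map $\tau(a)=a^{\mathrm T}$. Then every symmetry in $\mathfrak D$, i.e. every $s\in\mathfrak D$ with $s=s^*$ and $s^2=1$, is locally unitarily equivalent to $w$: there are unitary matrices $U,V\in M_n$ such that $s=(U\otimes V)\,w\,(U\otimes V)^*$. -/

import Mathlib

open scoped Matrix Kronecker ComplexOrder MatrixOrder Matrix.Norms.L2Operator

noncomputable section

namespace BlockPositive

/-- The matrix algebra `M_n(ℂ)`. -/
abbrev Mat (n : ℕ) : Type := Matrix (Fin n) (Fin n) ℂ

/-- The tensor product `M_n(ℂ) ⊗ M_n(ℂ)`, realised (through the Kronecker product `a ⊗ₖ b`) as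
the matrices with rows and columns indexed by pairs. -/
abbrev Mat₂ (n : ℕ) : Type := Matrix (Fin n × Fin n) (Fin n × Fin n) ℂ

/-- The product vector `x ⊗ y` in `ℂⁿ ⊗ ℂⁿ`. -/
def tensorVec {n : ℕ} (x y : Fin n → ℂ) : Fin n × Fin n → ℂ := fun k => x k.1 * y k.2

/-- The trace norm `‖a‖₁ = Tr |a| = Tr (a* a)^{1/2}`. The trace is a nonnegative real number, so
taking the real part only changes its type. -/
def traceNorm {n : ℕ} (a : Mat n) : ℝ := (Matrix.trace (CFC.sqrt (aᴴ * a))).re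

/-- The projective norm `π` on `M_n(ℂ) ⊗ M_n(ℂ)`: the first factor carries the operator norm, the
second factor the trace norm, and the infimum runs over all representations
`x = ∑ i, a i ⊗ b i` as finite sums. -/
def projNorm {n : ℕ} (x : Mat₂ n) : ℝ :=
  sInf {r : ℝ | ∃ (k : ℕ) (a b : Fin k → Mat n),
    x = ∑ i, a i ⊗ₖ b i ∧ r = ∑ i, ‖a i‖ * traceNorm (b i)}

/-- The norm `α` dual to the projective norm, `α(ρ) = sup_{a ≠ 0} |Tr (ρ a)| / π(a)`. -/
def alphaNorm {n : ℕ} (ρ : Mat₂ n) : ℝ :=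
  sSup {r : ℝ | ∃ a : Mat₂ n, a ≠ 0 ∧ r = ‖Matrix.trace (ρ * a)‖ / projNorm a}

/-- `ρ` is block-positive: `(x ⊗ y, ρ (x ⊗ y)) ≥ 0` for all `x, y ∈ ℂⁿ`. (For complex numbers,
`0 ≤ z` says that `z` is real and nonnegative.) -/
def IsBlockPositive {n : ℕ} (ρ : Mat₂ n) : Prop :=
  ∀ x y : Fin n → ℂ, 0 ≤ star (tensorVec x y) ⬝ᵥ (ρ *ᵥ tensorVec x y)

/-- The set `𝔇` of self-adjoint, block-positive, `α`-normalised matrices of trace `n`. -/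
def setD (n : ℕ) : Set (Mat₂ n) :=
  {ρ | ρ.IsHermitian ∧ alphaNorm ρ = 1 ∧ IsBlockPositive ρ ∧ Matrix.trace ρ = (n : ℂ)}

/-- A symmetry is a self-adjoint unitary: `s = s*` and `s² = 1`. -/
def IsSymmetry {n : ℕ} (s : Mat₂ n) : Prop := s.IsHermitian ∧ s ^ 2 = 1

/-- The Choi matrix `ρ_φ = ∑ i j, E_ij ⊗ φ(E_ij)` of a linear map `φ : M_n(ℂ) → M_n(ℂ)`. -/
def choiMatrix {n : ℕ} (φ : Mat n →ₗ[ℂ] Mat n) : Mat₂ n :=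
  ∑ i, ∑ j, Matrix.single i j (1 : ℂ) ⊗ₖ φ (Matrix.single i j (1 : ℂ))

/-- The transposition map `a ↦ aᵀ` on `M_n(ℂ)`. -/
def transposition (n : ℕ) : Mat n →ₗ[ℂ] Mat n :=
  (Matrix.transposeLinearEquiv (Fin n) (Fin n) ℂ ℂ).toLinearMap

/-- The Choi matrix of the transposition map is `∑ i j, E_ij ⊗ E_ji`. -/
theorem choiMatrix_transposition (n : ℕ) :
    choiMatrix (transposition n) =
      ∑ i, ∑ j, Matrix.single i j (1 : ℂ) ⊗ₖ Matrix.single j i (1 : ℂ) := by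
  simp [choiMatrix, transposition]

/-- `s` and `t` are locally unitarily equivalent: `s = (U ⊗ V) t (U ⊗ V)*` for some unitary
matrices `U, V ∈ M_n(ℂ)`. -/
def LocallyUnitarilyEquivalent {n : ℕ} (s t : Mat₂ n) : Prop :=
  ∃ U ∈ Matrix.unitaryGroup (Fin n) ℂ, ∃ V ∈ Matrix.unitaryGroup (Fin n) ℂ,
    s = (U ⊗ₖ V) * t * (U ⊗ₖ V)ᴴ

end BlockPositive

end

namespace BlockPositive
open Matrix

/-! Read `s` as the Choi matrix of the map `φ = choiMap s`, with `φ(E_ij) = block s i j`.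
Block-positivity makes `φ` positive; `α(s) = 1` gives `φ(1) ≤ 1`, and the trace condition forces
`φ(1) = 1` (`choiMap_one_eq_one`). Kadison's inequality then makes the symmetrised defect of
multiplicativity positive semidefinite, while `s² = 1` makes its sum over all matrix units vanish.
Hence the defect is identically zero and `φ` is a Jordan homomorphism (`choiMap_mul_add_mul`). Using
`s² = 1` once more kills `φ(E_ii) φ(E_ij)` for `j ≠ i`, which selects the antimultiplicative case
(`block_mul_block`). The blocks with indices swapped are therefore matrix units, conjugate to the
standard ones by a unitary `V`, and `s = (1 ⊗ V) w (1 ⊗ V)*`. -/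

/-! ### Norm estimates: bounding the pairing with product matrices. -/

theorem traceNorm_of_posSemidef {n : ℕ} {b : Mat n} (hb : b.PosSemidef) :
    traceNorm b = (trace b).re := by
  unfold traceNorm
  rw [hb.1.eq, CFC.sqrt_mul_self b hb.nonneg]

theorem norm_apply_le_opNorm {n : ℕ} (a : Mat n) (i j : Fin n) : ‖a i j‖ ≤ ‖a‖ := by
  have h := l2_opNorm_mulVec a (EuclideanSpace.single j (1 : ℂ))
  rw [PiLp.norm_single, norm_one, mul_one] at h
  refine le_trans ?_ h
  refine le_trans (le_of_eq ?_) (PiLp.norm_apply_le _ i)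
  simp [EuclideanSpace.single]

theorem opNorm_le_trace {n : ℕ} {h : Mat n} (hh : h.PosSemidef) : ‖h‖ ≤ (trace h).re := by
  conv_lhs => rw [hh.1.spectral_theorem, Unitary.conjStarAlgAut_apply, ← Unitary.coe_star,
    CStarRing.norm_mul_coe_unitary, CStarRing.norm_coe_unitary_mul, l2_opNorm_diagonal]
  rw [hh.1.trace_eq_sum_eigenvalues, Complex.re_sum]
  refine (pi_norm_le_iff_of_nonneg (Finset.sum_nonneg fun i _ => ?_)).2 fun i => ?_
  · exact hh.eigenvalues_nonneg i
  · have h1 : ‖(RCLike.ofReal ∘ hh.1.eigenvalues : Fin n → ℂ) i‖ = hh.1.eigenvalues i := by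
      simp [abs_of_nonneg (hh.eigenvalues_nonneg i)]
    rw [h1]
    exact Finset.single_le_sum (f := fun i => ((hh.1.eigenvalues i : ℂ)).re)
      (fun i _ => hh.eigenvalues_nonneg i) (Finset.mem_univ i)

theorem norm_apply_le_traceNorm {n : ℕ} (b : Mat n) (i j : Fin n) :
    ‖b i j‖ ≤ traceNorm b := by
  set h := CFC.sqrt (bᴴ * b) with hdef
  have hpos : h.PosSemidef := nonneg_iff_posSemidef.1 (CFC.sqrt_nonneg _)
  have hsq : h * h = bᴴ * b :=
    CFC.sqrt_mul_sqrt_self _ (posSemidef_conjTranspose_mul_self b).nonneg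
  have hnorm : ‖b‖ = ‖h‖ := by
    have h1 := l2_opNorm_conjTranspose_mul_self b
    have h2 := l2_opNorm_conjTranspose_mul_self h
    rw [hpos.1.eq, hsq, h1] at h2
    exact (mul_self_inj (norm_nonneg _) (norm_nonneg _)).1 h2
  refine (norm_apply_le_opNorm b i j).trans ?_
  rw [hnorm]
  exact opNorm_le_trace hpos

theorem traceNorm_nonneg {n : ℕ} (b : Mat n) : 0 ≤ traceNorm b := by
  have h : (0 : ℂ) ≤ trace (CFC.sqrt (bᴴ * b)) :=
    (nonneg_iff_posSemidef.1 (CFC.sqrt_nonneg _)).trace_nonneg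
  exact (Complex.le_def.1 h).1

theorem bddBelow_projNorm_set {n : ℕ} (x : Mat₂ n) :
    BddBelow {r : ℝ | ∃ (k : ℕ) (a b : Fin k → Mat n),
      x = ∑ i, a i ⊗ₖ b i ∧ r = ∑ i, ‖a i‖ * traceNorm (b i)} := by
  refine ⟨0, ?_⟩
  rintro r ⟨k, a, b, -, rfl⟩
  exact Finset.sum_nonneg fun i _ => mul_nonneg (norm_nonneg _) (traceNorm_nonneg _)

theorem projNorm_kronecker_le {n : ℕ} (a b : Mat n) :
    projNorm (a ⊗ₖ b) ≤ ‖a‖ * traceNorm b :=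
  csInf_le (bddBelow_projNorm_set _) ⟨1, fun _ => a, fun _ => b, by simp, by simp⟩

/-- Shows that `π` does not vanish on nonzero product matrices, so that the quotient defining `α` is
a genuine one there. -/
theorem norm_apply_le_projNorm_kronecker {n : ℕ} (a b : Mat n) (p q : Fin n × Fin n) :
    ‖(a ⊗ₖ b) p q‖ ≤ projNorm (a ⊗ₖ b) := by
  refine le_csInf ⟨_, 1, fun _ => a, fun _ => b, by simp, rfl⟩ ?_
  rintro r ⟨k, c, d, h, rfl⟩
  rw [h, Matrix.sum_apply]
  refine (norm_sum_le _ _).trans (Finset.sum_le_sum fun i _ => ?_)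
  rw [kroneckerMap_apply, norm_mul]
  exact mul_le_mul (norm_apply_le_opNorm _ _ _) (norm_apply_le_traceNorm _ _ _)
    (norm_nonneg _) (norm_nonneg _)

theorem norm_trace_mul_kronecker_le {n : ℕ} {s : Mat₂ n} (hs : alphaNorm s = 1) (a b : Mat n) :
    ‖trace (s * a ⊗ₖ b)‖ ≤ ‖a‖ * traceNorm b := by
  by_cases h0 : a ⊗ₖ b = 0
  · simpa [h0] using mul_nonneg (norm_nonneg a) (traceNorm_nonneg b)
  have hpos : 0 < projNorm (a ⊗ₖ b) := by
    by_contra hle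
    apply h0
    ext p q
    exact norm_le_zero_iff.1 ((norm_apply_le_projNorm_kronecker a b p q).trans (not_lt.1 hle))
  -- An unbounded set has real supremum `0` by convention, which contradicts `α(s) = 1`.
  have hbdd : BddAbove {r : ℝ | ∃ a : Mat₂ n, a ≠ 0 ∧ r = ‖trace (s * a)‖ / projNorm a} := by
    by_contra h
    unfold alphaNorm at hs
    rw [Real.sSup_of_not_bddAbove h] at hs
    exact zero_ne_one hs
  have h1 : ‖trace (s * a ⊗ₖ b)‖ / projNorm (a ⊗ₖ b) ≤ 1 :=
    hs ▸ le_csSup hbdd ⟨_, h0, rfl⟩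
  rw [div_le_one hpos] at h1
  exact h1.trans (projNorm_kronecker_le a b)

/-! ### The map with Choi matrix `s`: positivity and unitality. -/

/-- The `(i, j)` block of a matrix on `ℂⁿ ⊗ ℂⁿ`. -/
def block {n : ℕ} (s : Mat₂ n) (i j : Fin n) : Mat n := fun k l => s (i, k) (j, l)

/-- The linear map with Choi matrix `s`. -/
def choiMap {n : ℕ} (s : Mat₂ n) : Mat n →ₗ[ℂ] Mat n where
  toFun X := ∑ i, ∑ j, X i j • block s i j
  map_add' X Y := by simp [add_smul, Finset.sum_add_distrib]
  map_smul' c X := by simp [mul_smul, Finset.smul_sum]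

theorem choiMap_apply {n : ℕ} (s : Mat₂ n) (X : Mat n) :
    choiMap s X = ∑ i, ∑ j, X i j • block s i j := rfl

theorem choiMap_single {n : ℕ} (s : Mat₂ n) (i j : Fin n) :
    choiMap s (single i j 1) = block s i j := by
  rw [choiMap_apply, Finset.sum_eq_single i, Finset.sum_eq_single j]
  · simp
  · intro k _ hk; simp [hk.symm]
  · simp
  · intro k _ hk; simp [hk.symm]
  · simp

theorem choiMap_one {n : ℕ} (s : Mat₂ n) : choiMap s 1 = ∑ i, block s i i := by
  simp [choiMap_apply, Matrix.one_apply]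

theorem conjTranspose_block {n : ℕ} {s : Mat₂ n} (hs : s.IsHermitian) (i j : Fin n) :
    (block s i j)ᴴ = block s j i := by
  ext k l
  exact hs.apply (j, k) (i, l)

theorem choiMap_conjTranspose {n : ℕ} {s : Mat₂ n} (hs : s.IsHermitian) (X : Mat n) :
    choiMap s Xᴴ = (choiMap s X)ᴴ := by
  simp only [choiMap_apply, conjTranspose_sum, conjTranspose_smul, conjTranspose_block hs,
    conjTranspose_apply]
  exact Finset.sum_comm

theorem trace_mul_one_kronecker {n : ℕ} (s : Mat₂ n) (y : Fin n → ℂ) :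
    trace (s * (1 : Mat n) ⊗ₖ vecMulVec y (star y)) = star y ⬝ᵥ (choiMap s 1 *ᵥ y) := by
  simp only [trace, diag_apply, mul_apply, Fintype.sum_prod_type, kroneckerMap_apply, one_apply,
    vecMulVec_apply, dotProduct, mulVec, choiMap_one, Matrix.sum_apply, block, Finset.mul_sum,
    Finset.sum_mul, ite_mul, mul_ite, one_mul, zero_mul, mul_zero, Pi.star_apply]
  rw [Finset.sum_comm]
  refine Finset.sum_congr rfl fun k _ => ?_
  rw [Finset.sum_comm]
  simp
  rw [Finset.sum_comm]
  exact Finset.sum_congr rfl fun i _ => Finset.sum_congr rfl fun l _ => by ring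

theorem trace_choiMap_one {n : ℕ} (s : Mat₂ n) : trace (choiMap s 1) = trace s := by
  simp only [choiMap_one, trace_sum]
  simp [trace, Fintype.sum_prod_type, block]

theorem dotProduct_choiMap_vecMulVec {n : ℕ} (s : Mat₂ n) (x y : Fin n → ℂ) :
    star y ⬝ᵥ (choiMap s (vecMulVec x (star x)) *ᵥ y) =
      star (tensorVec (star x) y) ⬝ᵥ (s *ᵥ tensorVec (star x) y) := by
  simp only [dotProduct, mulVec, Fintype.sum_prod_type, choiMap_apply, vecMulVec_apply,
    Matrix.sum_apply, Matrix.smul_apply, smul_eq_mul, block, tensorVec, Finset.mul_sum,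
    Finset.sum_mul, Pi.star_apply, star_mul', star_star]
  refine (Finset.sum_congr rfl fun k _ => Finset.sum_comm).trans (Finset.sum_comm.trans ?_)
  refine Finset.sum_congr rfl fun i _ => Finset.sum_congr rfl fun k _ => ?_
  rw [Finset.sum_comm]
  refine Finset.sum_congr rfl fun j _ => Finset.sum_congr rfl fun l _ => ?_
  ring

theorem block_sum_mul {n : ℕ} {s : Mat₂ n} (hs : s ^ 2 = 1) (i k : Fin n) :
    ∑ j, block s i j * block s j k = if i = k then 1 else 0 := by
  ext a b
  have h := congrFun (congrFun hs (i, a)) (k, b)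
  rw [pow_two, mul_apply, Fintype.sum_prod_type] at h
  rw [Matrix.sum_apply]
  simp only [mul_apply, block]
  rw [h]
  by_cases hik : i = k <;> simp [hik, Matrix.one_apply]

theorem isHermitian_choiMap {n : ℕ} {s : Mat₂ n} (hs : s.IsHermitian) {X : Mat n}
    (hX : X.IsHermitian) : (choiMap s X).IsHermitian := by
  rw [IsHermitian, ← choiMap_conjTranspose hs, hX.eq]

theorem posSemidef_choiMap_vecMulVec {n : ℕ} {s : Mat₂ n} (hs : s.IsHermitian)
    (hpos : IsBlockPositive s) (x : Fin n → ℂ) :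
    (choiMap s (vecMulVec x (star x))).PosSemidef := by
  refine .of_dotProduct_mulVec_nonneg
    (isHermitian_choiMap hs (posSemidef_vecMulVec_self_star x).1) fun y => ?_
  rw [dotProduct_choiMap_vecMulVec]
  exact hpos _ _

theorem choiMap_one_eq_one {n : ℕ} {s : Mat₂ n} (hD : s ∈ setD n) : choiMap s 1 = 1 := by
  obtain ⟨hs, hα, hpos, htr⟩ := hD
  -- Pairing `s` with `1 ⊗ yy*` gives `(y, φ(1) y) ≤ ‖1‖ ‖yy*‖₁ ≤ (y, y)`.
  have hpsd : (1 - choiMap s 1).PosSemidef := by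
    refine .of_dotProduct_mulVec_nonneg
      (isHermitian_one.sub (isHermitian_choiMap hs isHermitian_one)) fun y => ?_
    have him := ((isHermitian_choiMap hs isHermitian_one).im_star_dotProduct_mulVec_self y)
    have h := norm_trace_mul_kronecker_le hα 1 (vecMulVec y (star y))
    rw [trace_mul_one_kronecker, traceNorm_of_posSemidef (posSemidef_vecMulVec_self_star y),
      trace_vecMulVec] at h
    have h1 : ‖(1 : Mat n)‖ ≤ 1 := by
      rcases subsingleton_or_nontrivial (Mat n) with _ | _
      · simp [Subsingleton.elim (1 : Mat n) 0]
      · exact CStarRing.norm_one.le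
    have hyy : (0 : ℂ) ≤ y ⬝ᵥ star y := dotProduct_self_star_nonneg y
    have hre := Complex.le_def.1 hyy
    rw [sub_mulVec, one_mulVec, dotProduct_sub, Complex.le_def, dotProduct_comm (star y) y]
    constructor
    · have h2 := (Complex.re_le_norm _).trans (h.trans (mul_le_of_le_one_left hre.1 h1))
      simpa using h2
    · have h3 := hre.2
      simp only [Complex.sub_im, Complex.zero_im] at *
      rw [← h3]
      simpa using him
  -- A positive semidefinite matrix of trace `n - n = 0` is zero.
  have h0 := hpsd.trace_eq_zero_iff.1 (by rw [trace_sub, trace_choiMap_one, htr]; simp)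
  exact (sub_eq_zero.1 h0).symm

/-! ### Kadison's inequality and the Jordan homomorphism property. -/

/-- Kadison's inequality for Hermitian matrices. -/
theorem posSemidef_choiMap_mul_self_sub {n : ℕ} {s : Mat₂ n} (hs : s.IsHermitian)
    (hpos : IsBlockPositive s) (h1 : choiMap s 1 = 1) {A : Mat n} (hA : A.IsHermitian) :
    (choiMap s (A * A) - choiMap s A * choiMap s A).PosSemidef := by
  set U : Mat n := (hA.eigenvectorUnitary : Matrix (Fin n) (Fin n) ℂ) with hU
  have hUU : U * star U = 1 := Unitary.coe_mul_star_self _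
  have hUU' : star U * U = 1 := Unitary.coe_star_mul_self _
  set P : Fin n → Mat n := fun k => vecMulVec (U.col k) (star (U.col k)) with hP
  have hdiag : ∀ d : Fin n → ℂ, U * diagonal d * star U = ∑ k, d k • P k := by
    intro d
    ext i j
    simp only [mul_apply, diagonal_apply, Matrix.sum_apply, Matrix.smul_apply, hP, vecMulVec_apply]
    refine Finset.sum_congr rfl fun k _ => ?_
    simp [star_apply]
    ring
  set l : Fin n → ℂ := fun k => (hA.eigenvalues k : ℂ) with hl
  have hlstar : ∀ k, star (l k) = l k := fun k => Complex.conj_ofReal _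
  have hAd : A = U * diagonal l * star U := by
    have := hA.spectral_theorem
    rwa [Unitary.conjStarAlgAut_apply] at this
  have hA1 : A = ∑ k, l k • P k := by rw [← hdiag]; exact hAd
  have hA2 : A * A = ∑ k, (l k * l k) • P k := by
    rw [← hdiag, ← diagonal_mul_diagonal]
    conv_lhs => rw [hAd]
    calc U * diagonal l * star U * (U * diagonal l * star U)
        = U * diagonal l * (star U * U) * diagonal l * star U := by noncomm_ring
      _ = _ := by rw [hUU', mul_one]; noncomm_ring
  have hI : (1 : Mat n) = ∑ k, P k := by
    have := hdiag 1
    simpa [hUU] using this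
  set G : Fin n → Mat n := fun k => choiMap s (P k) with hG
  have hGpos : ∀ k, (G k).PosSemidef := fun k => posSemidef_choiMap_vecMulVec hs hpos _
  have hG1 : ∑ k, G k = 1 := by rw [← h1]; conv_rhs => rw [hI, map_sum]
  set Y := choiMap s A with hY
  have hYG : Y = ∑ k, l k • G k := by
    rw [hY]; conv_lhs => rw [hA1, map_sum]
    simp [hG]
  have hYG2 : choiMap s (A * A) = ∑ k, (l k * l k) • G k := by
    rw [hA2, map_sum]
    simp [hG]
  have hYH : Yᴴ = Y := isHermitian_choiMap hs hA
  -- With `A = ∑ λ_k P_k` and `G_k = φ(P_k) ≥ 0`, `∑ G_k = 1`, the defect is an operator-valued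
  -- variance.
  have key : choiMap s (A * A) - Y * Y =
      ∑ k, (l k • (1 : Mat n) - Y)ᴴ * G k * (l k • (1 : Mat n) - Y) := by
    have h3 : ∀ k, (l k • (1 : Mat n) - Y)ᴴ * G k * (l k • (1 : Mat n) - Y) =
        (l k * l k) • G k - (l k • G k) * Y - Y * (l k • G k) + Y * G k * Y := by
      intro k
      rw [conjTranspose_sub, conjTranspose_smul, hlstar, conjTranspose_one, hYH]
      simp only [sub_mul, mul_sub, smul_mul_assoc, mul_smul_comm, one_mul, mul_one, mul_smul,
        smul_sub]
      abel
    simp only [h3]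
    rw [Finset.sum_add_distrib, Finset.sum_sub_distrib, Finset.sum_sub_distrib, ← Finset.sum_mul,
      ← Finset.mul_sum, ← Finset.sum_mul, ← Finset.mul_sum, ← hYG, hG1, ← hYG2]
    noncomm_ring
  rw [key]
  exact posSemidef_sum _ fun k _ => (hGpos k).conjTranspose_mul_mul_same _

/-- The symmetrised defect `φ(X*X + XX*) - φ(X)*φ(X) - φ(X)φ(X)*` of multiplicativity. -/
def jordanDefect {n : ℕ} (s : Mat₂ n) (X : Mat n) : Mat n :=
  choiMap s (Xᴴ * X + X * Xᴴ) - ((choiMap s X)ᴴ * choiMap s X + choiMap s X * (choiMap s X)ᴴ)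

/-- Half the sum of Kadison's inequalities for the Hermitian matrices `X + X*` and `i(X - X*)`,
whose squares add up to `2(X*X + XX*)`. -/
theorem posSemidef_jordanDefect {n : ℕ} {s : Mat₂ n} (hs : s.IsHermitian)
    (hpos : IsBlockPositive s) (h1 : choiMap s 1 = 1) (X : Mat n) :
    (jordanDefect s X).PosSemidef := by
  have hA : (X + Xᴴ).IsHermitian := isHermitian_add_transpose_self X
  have hB : (Complex.I • (X - Xᴴ)).IsHermitian := by
    rw [IsHermitian, conjTranspose_smul, conjTranspose_sub, conjTranspose_conjTranspose]
    simp only [Complex.star_def, Complex.conj_I, neg_smul, smul_sub]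
    abel
  have h := ((posSemidef_choiMap_mul_self_sub hs hpos h1 hA).add
    (posSemidef_choiMap_mul_self_sub hs hpos h1 hB)).smul (show (0 : ℂ) ≤ 1 / 2 by simp)
  convert h using 1
  have e2 : ∀ Z : Mat n, (Z + Zᴴ) * (Z + Zᴴ) +
      (Complex.I • (Z - Zᴴ)) * (Complex.I • (Z - Zᴴ)) =
      (2 : ℂ) • (Zᴴ * Z + Z * Zᴴ) := by
    intro Z
    rw [smul_mul_smul_comm, Complex.I_mul_I, two_smul, neg_one_smul]
    noncomm_ring
  have e3 : choiMap s (X + Xᴴ) = choiMap s X + (choiMap s X)ᴴ := by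
    rw [map_add, choiMap_conjTranspose hs]
  have e4 : choiMap s (Complex.I • (X - Xᴴ)) = Complex.I • (choiMap s X - (choiMap s X)ᴴ) := by
    rw [map_smul, map_sub, choiMap_conjTranspose hs]
  rw [sub_add_sub_comm, ← map_add, e2, e3, e4, e2, map_smul, ← smul_sub, smul_smul]
  simp [jordanDefect]

/-- The diagonal blocks of `s² = 1` say `∑ j, s_ij s_ji = 1`, so the product terms sum to `2n · 1`;
unitality gives the same total for the others. -/
theorem sum_jordanDefect_single {n : ℕ} {s : Mat₂ n} (hs : s.IsHermitian) (hsq : s ^ 2 = 1)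
    (h1 : choiMap s 1 = 1) :
    ∑ i, ∑ j, jordanDefect s (single i j 1) = 0 := by
  have e : ∀ i j, jordanDefect s (single i j 1) = block s j j + block s i i -
      (block s j i * block s i j + block s i j * block s j i) := by
    intro i j
    rw [jordanDefect, choiMap_single, conjTranspose_block hs, conjTranspose_single, star_one,
      single_mul_single_same, single_mul_single_same, one_mul, map_add, choiMap_single,
      choiMap_single]
  have hb : ∀ i, ∑ j, block s i j * block s j i = 1 := fun i => by
    simpa using block_sum_mul hsq i i
  have hI : ∑ i, block s i i = 1 := by rw [← choiMap_one, h1]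
  simp only [e, Finset.sum_sub_distrib, Finset.sum_add_distrib, hb, hI]
  rw [Finset.sum_comm (f := fun i j => block s j i * block s i j)]
  simp only [hb]
  simp only [Finset.sum_const, ← Finset.smul_sum, hI, sub_self]

theorem jordanDefect_add_add_sub {n : ℕ} (s : Mat₂ n) (X Y : Mat n) :
    jordanDefect s (X + Y) + jordanDefect s (X - Y) =
      (2 : ℂ) • jordanDefect s X + (2 : ℂ) • jordanDefect s Y := by
  simp only [jordanDefect, conjTranspose_add, conjTranspose_sub, map_add, map_sub, mul_add,
    add_mul, mul_sub, sub_mul, two_smul]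
  abel

theorem jordanDefect_eq_zero {n : ℕ} {s : Mat₂ n} (hs : s.IsHermitian) (hsq : s ^ 2 = 1)
    (hpos : IsBlockPositive s) (h1 : choiMap s 1 = 1) (X : Mat n) : jordanDefect s X = 0 := by
  have hnn : ∀ X, 0 ≤ jordanDefect s X := fun X => (posSemidef_jordanDefect hs hpos h1 X).nonneg
  have h0 := sum_jordanDefect_single hs hsq h1
  have hsingle : ∀ i j, jordanDefect s (single i j 1) = 0 := by
    intro i j
    rw [Finset.sum_eq_zero_iff_of_nonneg
      (fun i _ => Finset.sum_nonneg fun j _ => hnn _)] at h0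
    have h2 := h0 i (Finset.mem_univ i)
    rw [Finset.sum_eq_zero_iff_of_nonneg (fun j _ => hnn _)] at h2
    exact h2 j (Finset.mem_univ j)
  induction X using Matrix.induction_on' with
  | h_zero => simp [jordanDefect]
  | h_add X Y hX hY =>
    -- By the parallelogram law, two nonnegative defects add up to zero, so each vanishes.
    have h := jordanDefect_add_add_sub s X Y
    rw [hX, hY, smul_zero, add_zero] at h
    exact ((add_eq_zero_iff_of_nonneg (hnn _) (hnn _)).1 h).1
  | h_std_basis i j c =>
    have hc : (single i j c : Mat n) = c • single i j 1 := by simp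
    have hsm : jordanDefect s (c • single i j 1) = (star c * c) • jordanDefect s (single i j 1) := by
      simp only [jordanDefect, conjTranspose_smul, map_smul, smul_mul_smul_comm, smul_sub, smul_add,
        map_add, mul_comm c (star c)]
    rw [hc, hsm, hsingle, smul_zero]

theorem choiMap_mul_add_mul {n : ℕ} {s : Mat₂ n} (hs : s.IsHermitian) (hsq : s ^ 2 = 1)
    (hpos : IsBlockPositive s) (h1 : choiMap s 1 = 1) (X Y : Mat n) :
    choiMap s (X * Y + Y * X) = choiMap s X * choiMap s Y + choiMap s Y * choiMap s X := by
  have hz := jordanDefect_eq_zero hs hsq hpos h1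
  -- Polarization: `L` is the sesquilinear form of the defect; replacing `Y` by `iY` separates `L X
  -- Y` from `L Y X`.
  set L : Mat n → Mat n → Mat n := fun X Y => choiMap s (Xᴴ * Y + Y * Xᴴ) -
    ((choiMap s X)ᴴ * choiMap s Y + choiMap s Y * (choiMap s X)ᴴ) with hL
  have hadd : ∀ X Y, jordanDefect s (X + Y) =
      jordanDefect s X + jordanDefect s Y + L X Y + L Y X := by
    intro X Y
    simp only [jordanDefect, hL, conjTranspose_add, map_add, mul_add, add_mul]
    abel
  have hs1 : ∀ X Y, L X Y + L Y X = 0 := by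
    intro X Y
    have := hadd X Y
    rw [hz, hz, hz] at this
    simpa using this.symm
  have hs2 : ∀ X Y, L X (Complex.I • Y) = Complex.I • L X Y := by
    intro X Y
    simp only [hL, mul_smul_comm, smul_mul_assoc, map_smul, map_add, smul_sub, smul_add]
  have hs3 : ∀ X Y, L (Complex.I • Y) X = -(Complex.I • L Y X) := by
    intro X Y
    simp only [hL, conjTranspose_smul, map_smul, map_add, smul_sub,
      smul_add, Complex.star_def, Complex.conj_I, neg_smul, neg_mul, mul_neg, map_neg,
      mul_smul_comm, smul_mul_assoc]
    abel
  have hLz : L Xᴴ Y = 0 := by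
    have ha := hs1 Xᴴ Y
    have hb := hs1 Xᴴ (Complex.I • Y)
    rw [hs2, hs3, ← sub_eq_add_neg, ← smul_sub, smul_eq_zero, sub_eq_zero] at hb
    have hc := hb.resolve_left Complex.I_ne_zero
    rw [← hc, ← two_smul ℂ, smul_eq_zero] at ha
    exact ha.resolve_left two_ne_zero
  simp only [hL, choiMap_conjTranspose hs, conjTranspose_conjTranspose] at hLz
  exact sub_eq_zero.1 hLz

/-! ### Multiplication relations between the blocks. -/

theorem mul_eq_zero_of_sum_compression {n : ℕ} {ι : Type*} (t : Finset ι) (p : Mat n)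
    (f : ι → Mat n) (h : ∑ i ∈ t, p * f i * (p * f i)ᴴ = 0) : ∀ i ∈ t, p * f i = 0 := by
  intro i hi
  rw [Finset.sum_eq_zero_iff_of_nonneg
    fun i _ => (posSemidef_self_mul_conjTranspose (p * f i)).nonneg] at h
  exact self_mul_conjTranspose_eq_zero.1 (h i hi)

theorem block_mul_block_add {n : ℕ} {s : Mat₂ n} (hs : s.IsHermitian) (hsq : s ^ 2 = 1)
    (hpos : IsBlockPositive s) (h1 : choiMap s 1 = 1) (i j k l : Fin n) :
    block s i j * block s k l + block s k l * block s i j =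
      (if j = k then block s i l else 0) + (if l = i then block s k j else 0) := by
  have h := choiMap_mul_add_mul hs hsq hpos h1 (single i j 1) (single k l 1)
  rw [choiMap_single, choiMap_single, map_add] at h
  rw [← h]
  congr 1
  · split_ifs with hjk
    · subst hjk; rw [single_mul_single_same, one_mul, choiMap_single]
    · rw [single_mul_single_of_ne _ _ _ _ hjk, map_zero]
  · split_ifs with hli
    · subst hli; rw [single_mul_single_same, one_mul, choiMap_single]
    · rw [single_mul_single_of_ne _ _ _ _ hli, map_zero]

theorem block_self_mul_block_self {n : ℕ} {s : Mat₂ n} (hs : s.IsHermitian) (hsq : s ^ 2 = 1)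
    (hpos : IsBlockPositive s) (h1 : choiMap s 1 = 1) (i : Fin n) :
    block s i i * block s i i = block s i i := by
  have h := block_mul_block_add hs hsq hpos h1 i i i i
  rw [if_pos rfl, ← two_smul ℂ, ← two_smul ℂ (block s i i)] at h
  exact smul_right_injective _ (two_ne_zero (α := ℂ)) h

theorem block_self_mul_block_self_of_ne {n : ℕ} {s : Mat₂ n} (hs : s.IsHermitian)
    (hsq : s ^ 2 = 1) (hpos : IsBlockPositive s) (h1 : choiMap s 1 = 1) {i j : Fin n}
    (hij : i ≠ j) : block s i i * block s j j = 0 := by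
  have hp := block_self_mul_block_self hs hsq hpos h1 i
  have h := block_mul_block_add hs hsq hpos h1 i i j j
  -- Now `pq + qp = 0`. Multiplying by the idempotent `p` on either side gives `pq = -pqp = qp`,
  -- hence `2pq = 0`.
  rw [if_neg hij, if_neg hij.symm, add_zero] at h
  set p := block s i i
  set q := block s j j
  have h2 : p * q + p * q * p = 0 := by
    calc p * q + p * q * p = p * p * q + p * q * p := by rw [hp]
      _ = p * (p * q + q * p) := by noncomm_ring
      _ = 0 := by rw [h, mul_zero]
  have h3 : p * q * p + q * p = 0 := by
    calc p * q * p + q * p = p * q * p + q * (p * p) := by rw [hp]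
      _ = (p * q + q * p) * p := by noncomm_ring
      _ = 0 := by rw [h, zero_mul]
  have h4 : p * q = q * p := by
    rw [add_comm] at h3
    exact (eq_neg_of_add_eq_zero_left h2).trans (eq_neg_of_add_eq_zero_left h3).symm
  rw [← h4, ← two_smul ℂ, smul_eq_zero] at h
  exact h.resolve_left two_ne_zero

/-- This excludes the multiplicative case. With `p = s_ii`, the identity `p + ∑_{k≠i} s_ik s_ik* =
1` compressed by `p` gives `∑_{k≠i} (p s_ik)(p s_ik)* = 0`. -/
theorem block_self_mul_block {n : ℕ} {s : Mat₂ n} (hs : s.IsHermitian) (hsq : s ^ 2 = 1)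
    (hpos : IsBlockPositive s) (h1 : choiMap s 1 = 1) {i j : Fin n} (hij : j ≠ i) :
    block s i i * block s i j = 0 := by
  have hp := block_self_mul_block_self hs hsq hpos h1 i
  have hsum := block_sum_mul hsq i i
  rw [if_pos rfl, ← Finset.add_sum_erase _ _ (Finset.mem_univ i), hp] at hsum
  refine mul_eq_zero_of_sum_compression (Finset.univ.erase i) (block s i i) (block s i) ?_ j
    (Finset.mem_erase.2 ⟨hij, Finset.mem_univ _⟩)
  have h2 : ∑ k ∈ Finset.univ.erase i, block s i k * block s k i = 1 - block s i i := by
    rw [← hsum, add_sub_cancel_left]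
  calc ∑ k ∈ Finset.univ.erase i, block s i i * block s i k * (block s i i * block s i k)ᴴ
      = block s i i * (∑ k ∈ Finset.univ.erase i, block s i k * block s k i) * block s i i := by
        rw [Finset.mul_sum, Finset.sum_mul]
        refine Finset.sum_congr rfl fun k _ => ?_
        rw [conjTranspose_mul, conjTranspose_block hs, conjTranspose_block hs]
        noncomm_ring
    _ = 0 := by rw [h2, mul_sub, mul_one, hp, sub_self, zero_mul]

theorem block_mul_block_self {n : ℕ} {s : Mat₂ n} (hs : s.IsHermitian) (hsq : s ^ 2 = 1)
    (hpos : IsBlockPositive s) (h1 : choiMap s 1 = 1) (i j : Fin n) :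
    block s i j * block s i i = block s i j := by
  by_cases hij : j = i
  · subst hij; exact block_self_mul_block_self hs hsq hpos h1 j
  · have h := block_mul_block_add hs hsq hpos h1 i i i j
    rwa [block_self_mul_block hs hsq hpos h1 hij, if_pos rfl, if_neg hij, zero_add,
      add_zero] at h

theorem block_self_mul_block_right {n : ℕ} {s : Mat₂ n} (hs : s.IsHermitian) (hsq : s ^ 2 = 1)
    (hpos : IsBlockPositive s) (h1 : choiMap s 1 = 1) (i j : Fin n) :
    block s j j * block s i j = block s i j := by
  have h := congrArg conjTranspose (block_mul_block_self hs hsq hpos h1 j i)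
  rwa [conjTranspose_mul, conjTranspose_block hs, conjTranspose_block hs] at h

/-- The blocks satisfy the relations of the transposed matrix units. -/
theorem block_mul_block {n : ℕ} {s : Mat₂ n} (hs : s.IsHermitian) (hsq : s ^ 2 = 1)
    (hpos : IsBlockPositive s) (h1 : choiMap s 1 = 1) (i j k l : Fin n) :
    block s i j * block s k l = if i = l then block s k j else 0 := by
  have hne : ∀ i j k l, i ≠ l → block s i j * block s k l = 0 := by
    intro i j k l hil
    rw [← block_mul_block_self hs hsq hpos h1 i j, ← block_self_mul_block_right hs hsq hpos h1 k l,
      mul_assoc, ← mul_assoc (block s i i),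
      block_self_mul_block_self_of_ne hs hsq hpos h1 hil, zero_mul, mul_zero]
  split_ifs with hil
  · subst hil
    have h := block_mul_block_add hs hsq hpos h1 i j k i
    rw [if_pos rfl] at h
    by_cases hjk : j = k
    · subst hjk
      by_cases hij : i = j
      · subst hij; exact block_self_mul_block_self hs hsq hpos h1 i
      -- Left multiplication of `s_ij s_ji + s_ji s_ij = s_ii + s_jj` by `s_jj` leaves only `s_ij
      -- s_ji = s_jj`.
      · have h2 := congrArg (block s j j * ·) h
        simp only [if_true, mul_add, ← mul_assoc, block_self_mul_block_right hs hsq hpos h1 i j,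
          block_self_mul_block hs hsq hpos h1 hij, zero_mul, add_zero, zero_add,
          block_self_mul_block_self hs hsq hpos h1 j,
          block_self_mul_block_self_of_ne hs hsq hpos h1 (Ne.symm hij)] at h2
        exact h2
    · rwa [if_neg hjk, zero_add, hne k i i j (Ne.symm hjk), add_zero] at h
  · exact hne i j k l hil

/-! ### Matrix units up to unitary conjugation, and the conclusion. -/

/-- A system of `n × n` matrix units in `M_n(ℂ)` is unitarily equivalent to the standard one. -/
theorem exists_unitary_of_matrixUnits {n : ℕ} (G : Fin n → Fin n → Mat n)
    (hstar : ∀ i j, (G i j)ᴴ = G j i)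
    (hmul : ∀ i j k l, G i j * G k l = if j = k then G i l else 0) (hsum : ∑ i, G i i = 1) :
    ∃ V ∈ unitaryGroup (Fin n) ℂ, ∀ i j, G i j = V * single i j 1 * Vᴴ := by
  rcases isEmpty_or_nonempty (Fin n) with hn | ⟨⟨o⟩⟩
  · exact ⟨1, one_mem _, fun i => hn.elim i⟩
  have ho : G o o ≠ 0 := by
    intro h0
    have hz : ∀ i, G i i = 0 := fun i => by
      have h := hmul i o o i
      have h' := hmul i o o o
      rw [if_pos rfl, h0, mul_zero] at h'
      rw [if_pos rfl, ← h', zero_mul] at h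
      exact h.symm
    simp only [hz, Finset.sum_const_zero] at hsum
    exact zero_ne_one (congrFun (congrFun hsum o) o |>.trans (by simp))
  obtain ⟨w, hw⟩ : ∃ w, G o o *ᵥ w ≠ 0 := by
    by_contra! h
    exact ho (Matrix.ext_of_mulVec_single fun i => by rw [h, zero_mulVec])
  obtain ⟨v, hv, hvv⟩ : ∃ v : Fin n → ℂ, G o o *ᵥ v = v ∧ star v ⬝ᵥ v = 1 := by
    set u := G o o *ᵥ w with hu
    have hpos : (0 : ℂ) < star u ⬝ᵥ u := dotProduct_star_self_pos_iff.2 hw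
    obtain ⟨hre, him⟩ := Complex.lt_def.1 hpos
    have hr : star u ⬝ᵥ u = (((star u ⬝ᵥ u).re : ℝ) : ℂ) := Complex.ext rfl (by simpa using him.symm)
    set r := (star u ⬝ᵥ u).re
    refine ⟨((√r)⁻¹ : ℂ) • u, ?_, ?_⟩
    · rw [mulVec_smul, hu, mulVec_mulVec, hmul, if_pos rfl]
    · rw [star_smul, smul_dotProduct, dotProduct_smul, hr, Complex.star_def, map_inv₀,
        Complex.conj_ofReal, smul_eq_mul, smul_eq_mul, ← mul_assoc, ← mul_inv, ← Complex.ofReal_mul,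
        Real.mul_self_sqrt hre.le, inv_mul_cancel₀]
      exact_mod_cast hre.ne'
  -- For a unit vector `v` in the range of `G o o`, the vectors `G k o v` are orthonormal and
  -- permuted by the `G i j` like the standard basis by matrix units.
  set V : Mat n := Matrix.of fun a k => (G k o *ᵥ v) a with hV
  have hVV : Vᴴ * V = 1 := by
    ext i j
    have h2 : (Vᴴ * V) i j = star (G i o *ᵥ v) ⬝ᵥ (G j o *ᵥ v) := rfl
    rw [h2, star_mulVec, hstar, ← dotProduct_mulVec, mulVec_mulVec, hmul, one_apply]
    split_ifs
    · rw [hv, hvv]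
    · rw [zero_mulVec, dotProduct_zero]
  have hVV' : V * Vᴴ = 1 := mul_eq_one_comm.1 hVV
  refine ⟨V, mem_unitaryGroup_iff.2 hVV', fun i j => ?_⟩
  have hGV : G i j * V = V * single i j 1 := by
    ext a k
    have h2 : (G i j * V) a k = (G i j *ᵥ (G k o *ᵥ v)) a := rfl
    rw [h2, mulVec_mulVec, hmul, mul_apply]
    split_ifs with hjk
    · subst hjk
      simp [single_apply, hV]
    · simp [hjk]
  rw [← hGV, mul_assoc, hVV', mul_one]

theorem eq_sum_single_kronecker_block {n : ℕ} (s : Mat₂ n) :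
    s = ∑ i, ∑ j, single i j (1 : ℂ) ⊗ₖ block s i j := by
  ext ⟨i, k⟩ ⟨j, l⟩
  simp only [Matrix.sum_apply, kroneckerMap_apply, single_apply, block]
  rw [Finset.sum_eq_single i, Finset.sum_eq_single j] <;> simp +contextual

end BlockPositive

theorem mainTheorem1 (n : ℕ) (hn : n = 2 ∨ n = 3) (s : BlockPositive.Mat₂ n)
    (hsym : BlockPositive.IsSymmetry s) (hD : s ∈ BlockPositive.setD n) :
    BlockPositive.LocallyUnitarilyEquivalent s
      (BlockPositive.choiMatrix (BlockPositive.transposition n)) := by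
  open BlockPositive Matrix in
  obtain ⟨hs, hsq⟩ := hsym
  have h1 := choiMap_one_eq_one hD
  -- The swap of indices turns the antimultiplicative relations into those of matrix units.
  obtain ⟨V, hV, hG⟩ := exists_unitary_of_matrixUnits (fun i j => block s j i)
    (fun i j => conjTranspose_block hs j i)
    (fun i j k l => block_mul_block hs hsq hD.2.2.1 h1 j i l k)
    (by rw [← choiMap_one, h1])
  refine ⟨1, one_mem _, V, hV, ?_⟩
  rw [choiMatrix_transposition, conjTranspose_kronecker, conjTranspose_one, Finset.mul_sum,
    Finset.sum_mul]
  conv_lhs => rw [eq_sum_single_kronecker_block s]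
  refine Finset.sum_congr rfl fun i _ => ?_
  rw [Finset.mul_sum, Finset.sum_mul]
  refine Finset.sum_congr rfl fun j _ => ?_
  rw [← mul_kronecker_mul, ← mul_kronecker_mul, one_mul, mul_one, hG j i]
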